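/- Let $M$ be a closed (compact, Hausdorff, without boundary) topological manifold, for example a closed oriented manifold, and let $\pi_Q\colon Q\to M$ and $\pi_P\colon P\to M$ be oriented circle bundles, that is, principal $\mathbb S^1$-bundles (so $\mathbb S^1$ acts simply transitively on the fibers), with Euler classes $e(Q),e(P)\in H^2(M;\mathbb Z)$. Let $n\ge 1$ be an integer. A *fiberwise $n$-fold covering* is a continuous map $\phi\colon Q\to P$ with $\pi_P\circ\phi=\pi_Q$ and $\phi(\theta\cdot q)=\theta^n\cdot\phi(q)$ for all $\theta\in\mathbb S^1$, $q\in Q$; a *fiberwise covering* is a fiberwise $m$-fold covering for some $m\ge 1$. Let $\mathrm{Cov}(Q,P)$ be the set of fiberwise coverings $Q\to P$ up to homotopy through fiberwise coverings, and $\mathrm{Cov}_n(Q,P)\subseteq\mathrm{Cov}(Q,P)$ the subset of the classes of fiberwise $n$-fold coverings. For two fiberwise $n$-fold coverings $\phi_1,\phi_2$ let $f\colon M\to\mathbb S^1$ be the unique continuous map with $f(\pi_Q(q))\cdot\phi_1(q)=\phi_2(q)$ for all $q\in Q$; the *horizontal distance* of $\phi_1$ and $\phi_2$ is $d(\phi_1,\phi_2)=f^*[\mathbb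 S^1]\in H^1(M;\mathbb Z)$, where $[\mathbb S^1]\in H^1(\mathbb S^1;\mathbb Z)$ is the fundamental class. Then: 1. $\mathrm{Cov}_n(Q,P)$ is non-empty if and only if $n\cdot e(Q)=e(P)$. 2. If $\mathrm{Cov}_n(Q,P)$ is non-empty, then there is a simply transitive action of the group $H^1(M;\mathbb Z)$ on $\mathrm{Cov}_n(Q,P)$ such that $d(\phi_1,\phi_2)\cdot[\phi_1]=[\phi_2]$ for all fiberwise $n$-fold coverings $\phi_1,\phi_2\colon Q\to P$. Hence there is a one-to-one correspondence between $\mathrm{Cov}_n(Q,P)$ and $H^1(M;\mathbb Z)$. -/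

import Mathlib

open TopologicalSpace Topology

noncomputable section

namespace CircleBundle

universe u v w

/-! ## Čech cohomology with integer coefficients

Open covers of `X` are indexed by the points of `X`, the set with index `x` being an open
neighbourhood of `x`. Every open cover is refined by such a cover, and two of them have
the canonical common refinement `fun x ↦ U x ⊓ V x`, with refinement map the identity of the index
set; so Čech cohomology is the direct limit over these covers. A cochain of the direct limit is
represented by a family of functions on all of `X`, of which only the restrictions to the
intersections `U (i 0) ∩ ⋯ ∩ U (i k)`, for `U` fine enough, matter. -/

/-- Open covers indexed by the points of the space. -/
abbrev PointedCover (X : Type u) [TopologicalSpace X] : Type u := ∀ x : X, OpenNhdsOf x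

/-- The intersection `U (i 0) ∩ ⋯ ∩ U (i k)`. -/
def PointedCover.inter {X : Type u} [TopologicalSpace X] (U : PointedCover X) {k : ℕ}
    (i : Fin (k + 1) → X) : Set X :=
  {m | ∀ j, m ∈ U (i j)}

/-- Families of functions indexed by `(k + 1)`-tuples of indices. -/
abbrev CechCochain (X : Type u) (A : Type v) (k : ℕ) : Type max u v :=
  (Fin (k + 1) → X) → X → A

/-- The Čech differential `(d c)(i₀, …, iₖ₊₁) = ∑ⱼ (-1)ʲ c(i₀, …, îⱼ, …, iₖ₊₁)`. -/
def cechD {X : Type u} {A : Type v} [AddCommGroup A] {k : ℕ} :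
    CechCochain X A k →+ CechCochain X A (k + 1) where
  toFun c i m := ∑ j : Fin (k + 2), (-1 : ℤ) ^ (j : ℕ) • c (i ∘ j.succAbove) m
  map_zero' := by ext; simp
  map_add' c c' := by ext; simp [Finset.sum_add_distrib]

section Cohomology

variable (X : Type u) [TopologicalSpace X]

/-- Families whose members are continuous, that is, locally constant, integer valued functions
on the intersections of a suitable cover. -/
def cechContinuous (k : ℕ) : AddSubgroup (CechCochain X ℤ k) where
  carrier := {c | ∃ U : PointedCover X, ∀ i, ContinuousOn (c i) (U.inter i)}
  zero_mem' := ⟨fun _ => ⊤, fun _ => continuousOn_const⟩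
  add_mem' := by
    rintro c c' ⟨U, hU⟩ ⟨V, hV⟩
    exact ⟨fun x => U x ⊓ V x, fun i =>
      ((hU i).mono fun m hm j => (hm j).1).add ((hV i).mono fun m hm j => (hm j).2)⟩
  neg_mem' := by
    rintro c ⟨U, hU⟩
    exact ⟨U, fun i => (hU i).neg⟩

/-- Families that vanish on the intersections of a suitable cover; they represent the cochain
zero. -/
def cechNull (k : ℕ) : AddSubgroup (CechCochain X ℤ k) where
  carrier := {c | ∃ U : PointedCover X, ∀ i, ∀ m ∈ U.inter i, c i m = 0}
  zero_mem' := ⟨fun _ => ⊤, fun _ _ _ => rfl⟩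
  add_mem' := by
    rintro c c' ⟨U, hU⟩ ⟨V, hV⟩
    refine ⟨fun x => U x ⊓ V x, fun i m hm => ?_⟩
    simp [hU i m fun j => (hm j).1, hV i m fun j => (hm j).2]
  neg_mem' := by
    rintro c ⟨U, hU⟩
    exact ⟨U, fun i m hm => by simp [hU i m hm]⟩

/-- Čech cocycles with values in the constant sheaf `ℤ`. -/
def cechCocycle (k : ℕ) : AddSubgroup (CechCochain X ℤ k) :=
  cechContinuous X k ⊓ (cechNull X (k + 1)).comap cechD

/-- Čech coboundaries with values in the constant sheaf `ℤ`. -/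
def cechCoboundary : (k : ℕ) → AddSubgroup (CechCochain X ℤ k)
  | 0 => cechNull X 0
  | k + 1 => (cechContinuous X k).map cechD ⊔ cechNull X (k + 1)

/-- Čech cohomology `Hᵏ(X; ℤ)`: cocycles modulo coboundaries. -/
abbrev CechH (k : ℕ) : Type u :=
  cechCocycle X k ⧸ (cechCoboundary X k).addSubgroupOf (cechCocycle X k)

/-- The cohomology class of a cocycle. -/
def cechClass {k : ℕ} (c : cechCocycle X k) : CechH X k := QuotientAddGroup.mk c

end Cohomology

section Pullback

variable {X : Type u} {Y : Type v} [TopologicalSpace X] [TopologicalSpace Y]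

/-- The preimage of a cover: the set with index `x` is `f⁻¹ (U (f x))`. -/
def PointedCover.pullback (f : C(X, Y)) (U : PointedCover Y) : PointedCover X :=
  fun x => OpenNhdsOf.comap f x (U (f x))

/-- The pull-back of cochains, `(f^* c)(i₀, …, iₖ) = c(f i₀, …, f iₖ) ∘ f`. -/
def cechPullback (f : X → Y) (A : Type w) [AddCommGroup A] (k : ℕ) :
    CechCochain Y A k →+ CechCochain X A k where
  toFun c i m := c (f ∘ i) (f m)
  map_zero' := rfl
  map_add' _ _ := rfl

theorem cechPullback_continuous (f : C(X, Y)) {k : ℕ} {c : CechCochain Y ℤ k}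
    (hc : c ∈ cechContinuous Y k) : cechPullback f ℤ k c ∈ cechContinuous X k := by
  obtain ⟨U, hU⟩ := hc
  exact ⟨U.pullback f, fun i => (hU (f ∘ i)).comp f.continuous.continuousOn fun m hm j => hm j⟩

theorem cechPullback_null (f : C(X, Y)) {k : ℕ} {c : CechCochain Y ℤ k}
    (hc : c ∈ cechNull Y k) : cechPullback f ℤ k c ∈ cechNull X k := by
  obtain ⟨U, hU⟩ := hc
  exact ⟨U.pullback f, fun i m hm => hU (f ∘ i) (f m) fun j => hm j⟩

theorem cechPullback_cocycle (f : C(X, Y)) {k : ℕ} {c : CechCochain Y ℤ k}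
    (hc : c ∈ cechCocycle Y k) : cechPullback f ℤ k c ∈ cechCocycle X k :=
  ⟨cechPullback_continuous f hc.1, cechPullback_null f hc.2⟩

theorem cechPullback_coboundary (f : C(X, Y)) {k : ℕ} {c : CechCochain Y ℤ k}
    (hc : c ∈ cechCoboundary Y k) : cechPullback f ℤ k c ∈ cechCoboundary X k := by
  cases k with
  | zero => exact cechPullback_null f hc
  | succ k =>
    obtain ⟨_, ⟨b, hb, rfl⟩, z, hz, rfl⟩ := AddSubgroup.mem_sup.1 hc
    exact AddSubgroup.mem_sup.2 ⟨_, ⟨_, cechPullback_continuous f hb, rfl⟩, _,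
      cechPullback_null f hz, rfl⟩

/-- The induced map `f^* : Hᵏ(Y; ℤ) → Hᵏ(X; ℤ)`. -/
def cechMap (f : C(X, Y)) (k : ℕ) : CechH Y k →+ CechH X k :=
  QuotientAddGroup.map _ _
    (((cechPullback f ℤ k).comp (cechCocycle Y k).subtype).codRestrict (cechCocycle X k)
      fun c => cechPullback_cocycle f c.2)
    fun _ hc => cechPullback_coboundary f hc

end Pullback

/-! ## The fundamental class of the circle -/

/-- The universal covering `t ↦ exp (2πit)` of the circle. -/
def circ (t : ℝ) : Circle := Circle.exp (2 * Real.pi * t)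

/-- A logarithm of `z`, that is, `t` with `circ t = z`, continuous in `z` near `x`. -/
def circleLog (x z : Circle) : ℝ :=
  (Complex.arg (x : ℂ) + Complex.arg ((z / x : Circle) : ℂ)) / (2 * Real.pi)

/-- The open half circle around `x`, enlarged to the complement of the antipode of `x`. -/
def slitNhd : PointedCover Circle := fun x =>
  ⟨⟨{z | ((z / x : Circle) : ℂ) ∈ Complex.slitPlane},
    Complex.isOpen_slitPlane.preimage (by fun_prop)⟩, by
      change ((x / x : Circle) : ℂ) ∈ Complex.slitPlane
      simp⟩

theorem circ_add (s t : ℝ) : circ (s + t) = circ s * circ t := by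
  simp [circ, mul_add, Circle.exp_add]

theorem circ_neg (s : ℝ) : circ (-s) = (circ s)⁻¹ := by
  simp [circ, Circle.exp_neg]

theorem circ_sub (s t : ℝ) : circ (s - t) = circ s / circ t := by
  rw [sub_eq_add_neg, circ_add, circ_neg, div_eq_mul_inv]

theorem circ_eq_one {t : ℝ} : circ t = 1 ↔ ∃ n : ℤ, t = n := by
  rw [circ, Circle.exp_eq_one]
  refine exists_congr fun n => ?_
  rw [mul_comm, mul_left_inj' (by positivity)]

theorem round_of_circ {t : ℝ} (h : circ t = 1) : ((round t : ℤ) : ℝ) = t := by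
  obtain ⟨n, rfl⟩ := circ_eq_one.1 h
  simp

theorem circ_circleLog (x z : Circle) : circ (circleLog x z) = z := by
  rw [circ, circleLog, mul_div_cancel₀ _ (by positivity), Circle.exp_add, Circle.exp_arg,
    Circle.exp_arg, mul_div_cancel]

theorem continuousOn_circleLog (x : Circle) : ContinuousOn (circleLog x) (slitNhd x) := by
  unfold circleLog
  refine (continuousOn_const.add ?_).div_const _
  exact Complex.continuousOn_arg.comp (by fun_prop) fun z hz => hz

theorem cechD_one {X : Type u} {A : Type v} [AddCommGroup A] (c : CechCochain X A 1)
    (i : Fin 3 → X) (m : X) :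
    cechD c i m = c ![i 1, i 2] m - c ![i 0, i 2] m + c ![i 0, i 1] m := by
  have h0 : i ∘ (0 : Fin 3).succAbove = ![i 1, i 2] := by ext j; fin_cases j <;> rfl
  have h1 : i ∘ (1 : Fin 3).succAbove = ![i 0, i 2] := by ext j; fin_cases j <;> rfl
  have h2 : i ∘ (2 : Fin 3).succAbove = ![i 0, i 1] := by ext j; fin_cases j <;> rfl
  change ∑ j : Fin 3, (-1 : ℤ) ^ (j : ℕ) • c (i ∘ j.succAbove) m = _
  simp only [Fin.sum_univ_three, h0, h1, h2]
  simp [sub_eq_add_neg]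

/-- Rounding off preserves continuity on sets where the function takes integer values. -/
theorem continuousOn_round {X : Type u} [TopologicalSpace X] {f : X → ℝ} {S : Set X}
    (hf : ContinuousOn f S) (h : ∀ m ∈ S, circ (f m) = 1) :
    ContinuousOn (fun m => round (f m)) S := by
  rw [Int.isClosedEmbedding_coe_real.isInducing.continuousOn_iff]
  exact hf.congr fun m hm => round_of_circ (h m hm)

/-- The integral cocycle of the covering `circ`: its value on `(x, y)` is the difference of the
branches of the logarithm near `x` and near `y`. -/
def circleCochain : CechCochain Circle ℤ 1 :=
  fun i z => round (circleLog (i 0) z - circleLog (i 1) z)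

theorem coe_circleCochain (i : Fin 2 → Circle) (z : Circle) :
    (circleCochain i z : ℝ) = circleLog (i 0) z - circleLog (i 1) z :=
  round_of_circ (by rw [circ_sub, circ_circleLog, circ_circleLog, div_self'])

theorem circleCochain_mem : circleCochain ∈ cechCocycle Circle 1 := by
  refine ⟨⟨slitNhd, fun i => ?_⟩, ⟨slitNhd, fun i z _ => ?_⟩⟩
  · have h : ∀ j, ContinuousOn (circleLog (i j)) (slitNhd.inter i) := fun j =>
      (continuousOn_circleLog (i j)).mono fun z hz => hz j
    refine continuousOn_round ((h 0).sub (h 1)) fun z _ => ?_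
    rw [circ_sub, circ_circleLog, circ_circleLog, div_self']
  · rw [cechD_one, ← Int.cast_inj (α := ℝ)]
    push_cast [coe_circleCochain]
    simp

/-- The fundamental class `[S¹] ∈ H¹(S¹; ℤ)`, the generator given by the counterclockwise
orientation. -/
def circleClass : CechH Circle 1 := cechClass Circle ⟨circleCochain, circleCochain_mem⟩

/-! ## Circle bundles -/

/-- `π : Q → M` is an (oriented, that is, principal) circle bundle with respect to the given action
of the circle on `Q`: near every point of `M` there is a local trivialization that is
equivariant. In particular the action is simply transitive on the fibres. -/
structure IsCircleBundle {M : Type u} {Q : Type v} [TopologicalSpace M] [TopologicalSpace Q]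
    [MulAction Circle Q] (π : Q → M) : Prop where
  proj_smul : ∀ (θ : Circle) (q : Q), π (θ • q) = π q
  exists_trivialization : ∀ x : M, ∃ e : Bundle.Trivialization Circle π, x ∈ e.baseSet ∧
    ∀ (θ : Circle) (q : Q), π q ∈ e.baseSet → (e (θ • q)).2 = θ * (e q).2

theorem eq_of_triv {M : Type u} {Q : Type v} [TopologicalSpace M] [TopologicalSpace Q] {π : Q → M}
    {e : Bundle.Trivialization Circle π} {q q' : Q}
    (hq : π q ∈ e.baseSet) (hπ : π q' = π q) (h : (e q).2 = (e q').2) : q = q' := by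
  have h1 := e.symm_apply_mk_proj (e.mem_source.2 hq)
  have h2 := e.symm_apply_mk_proj (e.mem_source.2 (hπ ▸ hq))
  rw [← h1, ← h2, h, hπ]

section Bundle

variable {M : Type u} {Q : Type v} [TopologicalSpace M] [TopologicalSpace Q]
  [MulAction Circle Q] {π : Q → M}

theorem IsCircleBundle.smul_eq (hπ : IsCircleBundle π) {e : Bundle.Trivialization Circle π}
    (he : ∀ (θ : Circle) (q : Q), π q ∈ e.baseSet → (e (θ • q)).2 = θ * (e q).2)
    {q q' : Q} (hq : π q ∈ e.baseSet) (h : π q' = π q) : ((e q').2 / (e q).2) • q = q' := by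
  refine eq_of_triv (e := e) (by rwa [hπ.proj_smul]) (by rw [hπ.proj_smul, h]) ?_
  rw [he _ _ hq, div_mul_cancel]

theorem IsCircleBundle.smul_injective (hπ : IsCircleBundle π) {θ θ' : Circle} {q : Q}
    (h : θ • q = θ' • q) : θ = θ' := by
  obtain ⟨e, hx, he⟩ := hπ.exists_trivialization (π q)
  have := congrArg (fun q => (e q).2) h
  simpa [he _ _ hx] using this

/-- The element of the circle that carries `q` to `q'`, if these lie in the same fibre. -/
theorem IsCircleBundle.exists_smul (hπ : IsCircleBundle π) {q q' : Q} (h : π q' = π q) :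
    ∃ θ : Circle, θ • q = q' := by
  obtain ⟨e, hx, he⟩ := hπ.exists_trivialization (π q)
  exact ⟨_, hπ.smul_eq he hx h⟩

theorem IsCircleBundle.exists_section (hπ : IsCircleBundle π) (x : M) :
    ∃ (e : Bundle.Trivialization Circle π) (s : M → Q), x ∈ e.baseSet ∧
      ContinuousOn s e.baseSet ∧ (∀ m ∈ e.baseSet, π (s m) = m) ∧
      ∀ (θ : Circle) (q : Q), π q ∈ e.baseSet → (e (θ • q)).2 = θ * (e q).2 := by
  obtain ⟨e, hx, he⟩ := hπ.exists_trivialization x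
  exact ⟨e, fun m => e.toOpenPartialHomeomorph.symm (m, 1), hx, e.continuousOn_symm_prodMk_left,
    fun m hm => e.proj_symm_apply' hm, he⟩

/-- The quotient of two sections of a circle bundle is a continuous function to the circle. -/
theorem IsCircleBundle.continuousOn_of_smul (hπ : IsCircleBundle π) {X : Type w}
    [TopologicalSpace X] {S : Set X} {a b : X → Q} {g : X → Circle} (ha : ContinuousOn a S)
    (hb : ContinuousOn b S) (h : ∀ m ∈ S, g m • a m = b m) : ContinuousOn g S := by
  intro m hm
  obtain ⟨e, hx, he⟩ := hπ.exists_trivialization (π (a m))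
  have hπb : π (b m) = π (a m) := by rw [← h m hm, hπ.proj_smul]
  have ca : ContinuousWithinAt (fun m => e (a m)) S m :=
    (e.continuousAt (e.mem_source.2 hx)).comp_continuousWithinAt (ha m hm)
  have cb : ContinuousWithinAt (fun m => e (b m)) S m :=
    (e.continuousAt (e.mem_source.2 (hπb ▸ hx))).comp_continuousWithinAt (hb m hm)
  have key : ∀ m' ∈ S, a m' ∈ e.source → g m' = (e (b m')).2 / (e (a m')).2 := by
    intro m' hm' hs
    rw [← h m' hm', he _ _ (e.mem_source.1 hs), mul_div_cancel_right]
  have hev : ∀ᶠ m' in 𝓝[S] m, a m' ∈ e.source :=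
    (ha m hm).eventually (e.open_source.mem_nhds (e.mem_source.2 hx))
  refine (cb.snd.div' ca.snd).congr_of_eventuallyEq ?_ (key m hm (e.mem_source.2 hx))
  filter_upwards [hev, self_mem_nhdsWithin] with m' h1 h2 using key m' h2 h1

/-! ## The Euler class -/

/-- `e` is the Euler class of the circle bundle `π`, that is, the image of its class in
`H¹(M; S¹)` under the connecting homomorphism of the exponential sequence
`0 → ℤ → ℝ → S¹ → 1` of sheaves of continuous functions: given local sections `s x` of the
bundle over the sets of a cover, with `s y = exp (2πi r x y) • s x` on the intersections, the
cocycle `d r`, which is integer valued, represents `e`. This is the first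
Chern class of the associated complex line bundle. -/
def IsEulerClass (π : Q → M) (e : CechH M 2) : Prop :=
  ∃ (U : PointedCover M) (s : M → M → Q) (r : CechCochain M ℝ 1) (c : cechCocycle M 2),
    (∀ x, ContinuousOn (s x) (U x)) ∧ (∀ x, ∀ m ∈ U x, π (s x m) = m) ∧
    (∀ i, ContinuousOn (r i) (U.inter i)) ∧
    (∀ i, ∀ m ∈ U.inter i, s (i 1) m = circ (r i m) • s (i 0) m) ∧
    (∀ i, ∀ m ∈ U.inter i, (c.1 i m : ℝ) = cechD r i m) ∧
    e = cechClass M c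

theorem cechD_two_one {X : Type u} {A : Type v} [AddCommGroup A] (c : CechCochain X A 1) :
    cechD (cechD c) = 0 := by
  ext i m
  have e0 : i ∘ (0 : Fin 4).succAbove = ![i 1, i 2, i 3] := by ext j; fin_cases j <;> rfl
  have e1 : i ∘ (1 : Fin 4).succAbove = ![i 0, i 2, i 3] := by ext j; fin_cases j <;> rfl
  have e2 : i ∘ (2 : Fin 4).succAbove = ![i 0, i 1, i 3] := by ext j; fin_cases j <;> rfl
  have e3 : i ∘ (3 : Fin 4).succAbove = ![i 0, i 1, i 2] := by ext j; fin_cases j <;> rfl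
  change ∑ j : Fin 4, (-1 : ℤ) ^ (j : ℕ) • cechD c (i ∘ j.succAbove) m = 0
  simp only [Fin.sum_univ_four, e0, e1, e2, e3, cechD_one]
  simp
  abel

/-- Local sections with logarithms of their transition functions. -/
theorem IsCircleBundle.exists_logarithms [T2Space M] [CompactSpace M] (hπ : IsCircleBundle π) :
    ∃ (U : PointedCover M) (s : M → M → Q) (r : CechCochain M ℝ 1),
      (∀ x, ContinuousOn (s x) (U x)) ∧ (∀ x, ∀ m ∈ U x, π (s x m) = m) ∧
      (∀ i, ContinuousOn (r i) (U.inter i)) ∧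
      (∀ i, ∀ m ∈ U.inter i, s (i 1) m = circ (r i m) • s (i 0) m) := by
  let _ : UniformSpace M := uniformSpaceOfCompactR1
  choose e t hxe htc htπ _ using fun x => hπ.exists_section x
  -- a finite cover by trivializing sets, and closed sets `K a` inside them that still cover
  obtain ⟨F, hF⟩ := isCompact_univ.elim_finite_subcover (fun x => (e x).baseSet)
    (fun x => (e x).open_baseSet) (fun x _ => Set.mem_iUnion.2 ⟨x, hxe x⟩)
  obtain ⟨K, hKU, hKc, hKe⟩ := exists_iUnion_eq_closed_subset
    (u := fun a : F => (e a).baseSet) (fun a => (e a).open_baseSet) (fun x => Set.toFinite _)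
    (Set.eq_univ_of_forall fun x => by simpa using hF (Set.mem_univ x))
  choose α hα using fun x => Set.mem_iUnion.1 (hKU.symm ▸ Set.mem_univ x : x ∈ Set.iUnion K)
  -- the transition functions
  have hg : ∀ (a b : F) (m : M), ∃ θ : Circle, m ∈ (e a).baseSet → m ∈ (e b).baseSet →
      θ • t a m = t b m := by
    intro a b m
    by_cases h : m ∈ (e a).baseSet ∧ m ∈ (e b).baseSet
    · obtain ⟨θ, hθ⟩ := hπ.exists_smul (q := t a m) (q' := t b m)
        (by rw [htπ _ _ h.1, htπ _ _ h.2])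
      exact ⟨θ, fun _ _ => hθ⟩
    · exact ⟨1, fun h1 h2 => (h ⟨h1, h2⟩).elim⟩
  choose g hg using hg
  have hgc : ∀ a b, ContinuousOn (g a b) ((e a).baseSet ∩ (e b).baseSet) := fun a b =>
    hπ.continuousOn_of_smul ((htc a).mono Set.inter_subset_left)
      ((htc b).mono Set.inter_subset_right) fun m hm => hg a b m hm.1 hm.2
  -- neighbourhoods of `p` on which the transition functions vary little
  let S : M → Set M := fun p => {m | (∀ a, m ∈ K a → p ∈ K a) ∧ ∀ a b, p ∈ K a → p ∈ K b →
    m ∈ (e a).baseSet ∧ m ∈ (e b).baseSet ∧ g a b m ∈ slitNhd (g a b p)}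
  have hS : ∀ p ∈ Set.univ, S p ∈ 𝓝 p := by
    intro p _
    refine Filter.inter_mem (Filter.eventually_all.2 fun a => ?_)
      (Filter.eventually_all.2 fun a => Filter.eventually_all.2 fun b => ?_)
    · by_cases h : p ∈ K a
      · exact Filter.Eventually.of_forall fun _ _ => h
      · filter_upwards [(hKc a).isOpen_compl.mem_nhds h] with m hm hm' using (hm hm').elim
    · by_cases h : p ∈ K a ∧ p ∈ K b
      · have ha := (e a).open_baseSet.mem_nhds (hKe a h.1)
        have hb := (e b).open_baseSet.mem_nhds (hKe b h.2)
        have hc := ((hgc a b).continuousAt (Filter.inter_mem ha hb)).preimage_mem_nhds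
          ((slitNhd (g a b p)).isOpen.mem_nhds (slitNhd (g a b p)).mem)
        filter_upwards [ha, hb, hc] with m h1 h2 h3 _ _ using ⟨h1, h2, h3⟩
      · exact Filter.Eventually.of_forall fun _ h1 h2 => (h ⟨h1, h2⟩).elim
  obtain ⟨V, hV, hVS⟩ := lebesgue_number_lemma_nhds isCompact_univ hS
  obtain ⟨W, hW, hWs, hWV⟩ := comp_symm_mem_uniformity_sets hV
  let U : PointedCover M := fun x => ⟨⟨interior (UniformSpace.ball x W), isOpen_interior⟩,
    mem_interior_iff_mem_nhds.2 (UniformSpace.ball_mem_nhds x hW)⟩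
  have hUW : ∀ x m, m ∈ U x → (x, m) ∈ W := fun x m hm =>
    interior_subset (s := UniformSpace.ball x W) hm
  have hUe : ∀ x m, m ∈ U x → m ∈ (e (α x)).baseSet := by
    intro x m hm
    obtain ⟨p, hp⟩ := hVS x trivial
    have hx : x ∈ S p := hp (UniformSpace.mem_ball_self x hV)
    have hm' : m ∈ S p := hp (hWV (SetRel.prodMk_mem_comp (hUW x m hm) (refl_mem_uniformity hW)))
    exact (hm'.2 _ _ (hx.1 _ (hα x)) (hx.1 _ (hα x))).1
  have hlog : ∀ i : Fin 2 → M, ∃ f : M → ℝ, ContinuousOn f (U.inter i) ∧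
      ∀ m ∈ U.inter i, t (α (i 1)) m = circ (f m) • t (α (i 0)) m := by
    intro i
    by_cases hne : (U.inter i).Nonempty
    · obtain ⟨m₀, hm₀⟩ := hne
      obtain ⟨p, hp⟩ := hVS (i 0) trivial
      have h0 : i 0 ∈ S p := hp (UniformSpace.mem_ball_self _ hV)
      have h1 : i 1 ∈ S p := hp (hWV (SetRel.prodMk_mem_comp (hUW _ _ (hm₀ 0))
        (hWs.symm _ _ (hUW _ _ (hm₀ 1)))))
      have hm : ∀ m ∈ U.inter i, m ∈ S p := fun m hm =>
        hp (hWV (SetRel.prodMk_mem_comp (hUW _ _ (hm 0)) (refl_mem_uniformity hW)))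
      have hm' := fun m h => (hm m h).2 _ _ (h0.1 _ (hα _)) (h1.1 _ (hα _))
      refine ⟨fun m => circleLog (g (α (i 0)) (α (i 1)) p) (g (α (i 0)) (α (i 1)) m),
        (continuousOn_circleLog _).comp ((hgc _ _).mono fun m h => ⟨(hm' m h).1, (hm' m h).2.1⟩)
          fun m h => (hm' m h).2.2, fun m h => ?_⟩
      rw [circ_circleLog, hg _ _ _ (hm' m h).1 (hm' m h).2.1]
    · exact ⟨0, continuousOn_const, fun m h => (hne ⟨m, h⟩).elim⟩
  choose r hrc hr using hlog
  exact ⟨U, fun x => t (α x), r, fun x => (htc _).mono fun m hm => hUe x m hm,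
    fun x m hm => htπ _ _ (hUe x m hm), hrc, hr⟩

/-- The Euler class exists. -/
theorem IsCircleBundle.exists_isEulerClass [T2Space M] [CompactSpace M] (hπ : IsCircleBundle π) :
    ∃ e, IsEulerClass π e := by
  obtain ⟨U, s, r, hs, hs', hr, hr'⟩ := hπ.exists_logarithms
  have hpair : ∀ a b m, m ∈ U a → m ∈ U b → m ∈ U.inter ![a, b] := by
    intro a b m ha hb j
    fin_cases j
    exacts [ha, hb]
  have hr2 : ∀ a b m, m ∈ U a → m ∈ U b → s b m = circ (r ![a, b] m) • s a m :=
    fun a b m ha hb => hr' ![a, b] m (hpair a b m ha hb)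
  have hone : ∀ i, ∀ m ∈ U.inter i, circ (cechD r i m) = 1 := by
    intro i m hm
    rw [cechD_one, circ_add, circ_sub, div_mul_eq_mul_div, div_eq_one]
    refine hπ.smul_injective (q := s (i 0) m) ?_
    rw [mul_smul, ← hr2 _ _ _ (hm 0) (hm 1), ← hr2 _ _ _ (hm 1) (hm 2),
      ← hr2 _ _ _ (hm 0) (hm 2)]
  have hmem : (fun i m => round (cechD r i m)) ∈ cechCocycle M 2 := by
    refine ⟨⟨U, fun i => continuousOn_round ?_ (hone i)⟩, ⟨U, fun i m hm => ?_⟩⟩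
    · have : cechD r i = fun m => r ![i 1, i 2] m - r ![i 0, i 2] m + r ![i 0, i 1] m :=
        funext fun m => cechD_one r i m
      rw [this]
      have h : ∀ a b, ContinuousOn (r ![i a, i b]) (U.inter i) := fun a b =>
        (hr _).mono fun m hm => hpair _ _ _ (hm a) (hm b)
      exact ((h 1 2).sub (h 0 2)).add (h 0 1)
    · rw [← Int.cast_inj (α := ℝ), Int.cast_zero, ← Pi.zero_apply (M := fun _ => ℝ) m,
        ← Pi.zero_apply (M := fun _ => M → ℝ) i, ← cechD_two_one r]
      simp only [cechD, AddMonoidHom.coe_mk, ZeroHom.coe_mk]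
      push_cast
      refine Finset.sum_congr rfl fun j _ => ?_
      change (((-1 : ℤ) ^ (j : ℕ) • round (cechD r (i ∘ j.succAbove) m) : ℤ) : ℝ) =
        (-1 : ℤ) ^ (j : ℕ) • cechD r (i ∘ j.succAbove) m
      have hj : circ (cechD r (i ∘ j.succAbove) m) = 1 := hone _ m fun l => hm _
      simp only [smul_eq_mul, zsmul_eq_mul, Int.cast_mul, round_of_circ hj]
  exact ⟨_, U, s, r, ⟨_, hmem⟩, hs, hs', hr, hr',
    fun i m hm => round_of_circ (hone i m hm), rfl⟩

/-- The Euler class is unique. -/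
theorem IsCircleBundle.isEulerClass_unique (hπ : IsCircleBundle π) {e e' : CechH M 2}
    (h : IsEulerClass π e) (h' : IsEulerClass π e') : e = e' := by
  obtain ⟨U, s, r, c, hs, hsπ, hr, hsr, hc, rfl⟩ := h
  obtain ⟨U', s', r', c', hs', hsπ', hr', hsr', hc', rfl⟩ := h'
  have hg : ∀ x m, ∃ θ : Circle, m ∈ (U x : Set M) ∩ U' x → θ • s x m = s' x m := by
    intro x m
    by_cases h : m ∈ (U x : Set M) ∩ U' x
    · obtain ⟨θ, hθ⟩ := hπ.exists_smul (q := s x m) (q' := s' x m)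
        (by rw [hsπ _ _ h.1, hsπ' _ _ h.2])
      exact ⟨θ, fun _ => hθ⟩
    · exact ⟨1, fun h1 => (h h1).elim⟩
  choose g hg using hg
  have hgc : ∀ x, ContinuousOn (g x) ((U x : Set M) ∩ U' x) := fun x =>
    hπ.continuousOn_of_smul ((hs x).mono Set.inter_subset_left)
      ((hs' x).mono Set.inter_subset_right) (hg x)
  let V : PointedCover M := fun x => ⟨⟨((U x : Set M) ∩ U' x) ∩ g x ⁻¹' slitNhd (g x x),
    (hgc x).isOpen_inter_preimage ((U x).isOpen.inter (U' x).isOpen) (slitNhd _).isOpen⟩,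
    ⟨⟨(U x).mem, (U' x).mem⟩, (slitNhd _).mem⟩⟩
  let ρ : M → M → ℝ := fun x m => circleLog (g x x) (g x m)
  have hρ : ∀ x m, circ (ρ x m) = g x m := fun x m => circ_circleLog _ _
  have hρc : ∀ x, ContinuousOn (ρ x) (V x) := fun x =>
    (continuousOn_circleLog _).comp ((hgc x).mono Set.inter_subset_left) fun m hm => hm.2
  have hρi : ∀ (i : Fin 2 → M) j, ContinuousOn (ρ (i j)) (V.inter i) := fun i j =>
    (hρc (i j)).mono fun m hm => hm j
  let β : CechCochain M ℝ 1 := fun i m => r' i m - r i m - (ρ (i 1) m - ρ (i 0) m)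
  have hβ : ∀ i, ∀ m ∈ V.inter i, circ (β i m) = 1 := by
    intro i m hm
    have e0 := hg _ _ (hm 0).1
    have e1 := hg _ _ (hm 1).1
    have e2 := hsr i m fun j => (hm j).1.1
    have e3 := hsr' i m fun j => (hm j).1.2
    have : (circ (r' i m) * g (i 0) m) • s (i 0) m = (g (i 1) m * circ (r i m)) • s (i 0) m := by
      rw [mul_smul, mul_smul, e0, ← e2, e1, ← e3]
    have := hπ.smul_injective this
    simp only [β, circ_sub, hρ]
    rw [div_div_div_eq, this, mul_comm, div_self']
  have hβc : ∀ i, ContinuousOn (β i) (V.inter i) := fun i =>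
    (((hr' i).mono fun m hm j => (hm j).1.2).sub ((hr i).mono fun m hm j => (hm j).1.1)).sub
      ((hρi i 1).sub (hρi i 0))
  refine (QuotientAddGroup.eq (s := (cechCoboundary M 2).addSubgroupOf (cechCocycle M 2))).2 ?_
  let b : CechCochain M ℤ 1 := fun i m => round (β i m)
  refine AddSubgroup.mem_sup.2 ⟨cechD b, ⟨b, ⟨V, fun i => continuousOn_round (hβc i) (hβ i)⟩, rfl⟩,
    -c.1 + c'.1 - cechD b, ⟨V, fun i m hm => ?_⟩, by simp⟩
  have hb : ∀ x y, (b ![i x, i y] m : ℝ) = β ![i x, i y] m := by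
    intro x y
    refine round_of_circ (hβ _ m fun j => ?_)
    fin_cases j
    exacts [hm x, hm y]
  have h1 := hc i m fun j => (hm j).1.1
  have h2 := hc' i m fun j => (hm j).1.2
  rw [cechD_one] at h1 h2
  change -c.1 i m + c'.1 i m - cechD b i m = 0
  rw [cechD_one, ← Int.cast_inj (α := ℝ)]
  push_cast [hb, h1, h2]
  simp only [β, Matrix.cons_val_zero, Matrix.cons_val_one]
  ring

/-- The Euler class `e(Q) ∈ H²(M; ℤ)` of a circle bundle over a compact Hausdorff space. -/
def eulerClass [T2Space M] [CompactSpace M] (hπ : IsCircleBundle π) : CechH M 2 :=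
  hπ.exists_isEulerClass.choose

theorem isEulerClass_eulerClass [T2Space M] [CompactSpace M] (hπ : IsCircleBundle π) :
    IsEulerClass π (eulerClass hπ) :=
  hπ.exists_isEulerClass.choose_spec

end Bundle

/-! ## Fiberwise coverings -/

section Covering

variable {M : Type u} {Q : Type v} {P : Type w} [TopologicalSpace M]
  [TopologicalSpace Q] [MulAction Circle Q] [TopologicalSpace P] [MulAction Circle P]

/-- `φ` is a fiberwise `n`-fold covering, `n ≥ 1`: it maps each fibre of `Q` to the fibre of `P`
over the same point, and there it is `θ ↦ θⁿ` when both fibres are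
identified with the circle by the choice of a point in the first and its image in the second. -/
def IsFiberwiseCovering (πQ : Q → M) (πP : P → M) (n : ℕ) (φ : C(Q, P)) : Prop :=
  0 < n ∧ (∀ q, πP (φ q) = πQ q) ∧ ∀ (θ : Circle) (q : Q), φ (θ • q) = θ ^ n • φ q

variable (πQ : Q → M) (πP : P → M)

/-- The space of fiberwise coverings, with any number of sheets. -/
abbrev FiberwiseCovering : Type max v w := {φ : C(Q, P) // ∃ n, IsFiberwiseCovering πQ πP n φ}

/-- Homotopy through fiberwise coverings. -/
def coveringSetoid : Setoid (FiberwiseCovering πQ πP) where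
  r φ ψ := ContinuousMap.HomotopicWith φ.1 ψ.1 fun χ => ∃ n, IsFiberwiseCovering πQ πP n χ
  iseqv := ⟨fun φ => .refl φ.1 φ.2, fun h => h.symm, fun h h' => h.trans h'⟩

/-- `Cov(Q, P)`: homotopy classes of fiberwise coverings. -/
def Cov : Type max v w := Quotient (coveringSetoid πQ πP)

variable {πQ πP}

/-- The class of a fiberwise covering in `Cov(Q, P)`. -/
def covClass {n : ℕ} {φ : C(Q, P)} (h : IsFiberwiseCovering πQ πP n φ) : Cov πQ πP :=
  Quotient.mk (coveringSetoid πQ πP) ⟨φ, n, h⟩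

variable (πQ πP)

/-- `Covₙ(Q, P)`: the set of the homotopy classes of fiberwise `n`-fold coverings. -/
def CovN (n : ℕ) : Set (Cov πQ πP) :=
  {a | ∃ (φ : C(Q, P)) (h : IsFiberwiseCovering πQ πP n φ), covClass h = a}

variable {πQ πP}

/-- The class of a fiberwise `n`-fold covering in `Covₙ(Q, P)`. -/
def covNClass {n : ℕ} {φ : C(Q, P)} (h : IsFiberwiseCovering πQ πP n φ) : CovN πQ πP n :=
  ⟨covClass h, φ, h, rfl⟩

/-- For two fiberwise `n`-fold coverings there is a unique continuous `f : M → S¹` with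
`f(p) • φ₁(q) = φ₂(q)` for all `p ∈ M` and all `q` in the fibre over `p`. -/
theorem exists_relativeMap (hQ : IsCircleBundle πQ) (hP : IsCircleBundle πP) {n : ℕ}
    {φ₁ φ₂ : C(Q, P)} (h₁ : IsFiberwiseCovering πQ πP n φ₁)
    (h₂ : IsFiberwiseCovering πQ πP n φ₂) :
    ∃! f : C(M, Circle), ∀ q, f (πQ q) • φ₁ q = φ₂ q := by
  have hsurj : ∀ x, ∃ q, πQ q = x := fun x => by
    obtain ⟨e, s, hx, -, hs, -⟩ := hQ.exists_section x
    exact ⟨s x, hs x hx⟩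
  choose q₀ hq₀ using hsurj
  have hfib : ∀ q, πP (φ₂ q) = πP (φ₁ q) := fun q => by rw [h₁.2.1, h₂.2.1]
  choose f hf using fun x => hP.exists_smul (hfib (q₀ x))
  have key : ∀ q, f (πQ q) • φ₁ q = φ₂ q := by
    intro q
    obtain ⟨θ, hθ⟩ := hQ.exists_smul (q := q₀ (πQ q)) (q' := q) (by rw [hq₀])
    have e₁ : φ₁ q = θ ^ n • φ₁ (q₀ (πQ q)) := by rw [← h₁.2.2, hθ]
    have e₂ : φ₂ q = θ ^ n • φ₂ (q₀ (πQ q)) := by rw [← h₂.2.2, hθ]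
    rw [e₁, e₂, smul_comm, hf]
  have hcont : Continuous f := by
    rw [continuous_iff_continuousAt]
    intro x
    obtain ⟨e, s, hx, hs, hs', -⟩ := hQ.exists_section x
    refine ContinuousOn.continuousAt (s := e.baseSet) ?_ (e.open_baseSet.mem_nhds hx)
    refine hP.continuousOn_of_smul (a := fun m => φ₁ (s m)) (b := fun m => φ₂ (s m))
      (φ₁.continuous.comp_continuousOn hs) (φ₂.continuous.comp_continuousOn hs) fun m hm => ?_
    have := key (s m)
    rwa [hs' m hm] at this
  refine ⟨⟨f, hcont⟩, key, fun g hg => ?_⟩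
  ext1 x
  obtain ⟨q, rfl⟩ : ∃ q, πQ q = x := ⟨_, hq₀ x⟩
  exact hP.smul_injective ((hg q).trans (key q).symm)

/-- The map `f : M → S¹` with `f(p) • φ₁(q) = φ₂(q)` for all `q` in the fibre over `p`. -/
def relativeMap (hQ : IsCircleBundle πQ) (hP : IsCircleBundle πP) {n : ℕ}
    {φ₁ φ₂ : C(Q, P)} (h₁ : IsFiberwiseCovering πQ πP n φ₁)
    (h₂ : IsFiberwiseCovering πQ πP n φ₂) : C(M, Circle) :=
  (exists_relativeMap hQ hP h₁ h₂).choose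

theorem relativeMap_smul (hQ : IsCircleBundle πQ) (hP : IsCircleBundle πP) {n : ℕ}
    {φ₁ φ₂ : C(Q, P)} (h₁ : IsFiberwiseCovering πQ πP n φ₁)
    (h₂ : IsFiberwiseCovering πQ πP n φ₂) (q : Q) :
    relativeMap hQ hP h₁ h₂ (πQ q) • φ₁ q = φ₂ q :=
  (exists_relativeMap hQ hP h₁ h₂).choose_spec.1 q

/-- The horizontal distance `f^*[S¹] ∈ H¹(M; ℤ)` of two fiberwise `n`-fold coverings. -/
def horizontalDistance (hQ : IsCircleBundle πQ) (hP : IsCircleBundle πP) {n : ℕ}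
    {φ₁ φ₂ : C(Q, P)} (h₁ : IsFiberwiseCovering πQ πP n φ₁)
    (h₂ : IsFiberwiseCovering πQ πP n φ₂) : CechH M 1 :=
  cechMap (relativeMap hQ hP h₁ h₂) 1 circleClass

end Covering

end CircleBundle

end

/-!
Write `κ f = f^*[S¹]` for the class of a map `f : M → S¹`. Everything rests on two facts about `κ`
and on the fact that the sheaf of continuous real functions has partitions of unity
(`exists_eq_sub_of_cechD_eq_zero`).

*Degree one classes are homotopy classes of maps to the circle.* The map `κ` is a homomorphism
(`circleMapClass_mul`), and it is onto: an integral cocycle is the coboundary of continuous real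
functions `h x`, which agree modulo `ℤ` and hence define a map to the circle
(`circleMapClass_surjective`). Its kernel consists of the maps that lift to `ℝ`
(`exists_lift_of_circleMapClass_eq_zero`). Such maps are visibly homotopic to `1`; conversely the
kernel is an open, hence also closed, subgroup of the topological group `C(M, S¹)` when `M` is
compact, so it contains every path starting at `1` (`circleMapClass_eq_zero_of_path`).

*Coverings form a torsor.* Two `n`-fold coverings differ by rotation by a map `f : M → S¹`, and the
number of sheets cannot change along a homotopy through fiberwise coverings, so the coverings are
homotopic if and only if `f` is homotopic to `1`, that is, if their horizontal distance `κ f`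
vanishes (`covNClass_eq_iff`). The distance is additive and all its values occur. Hence the distance
from a fixed covering identifies `Covₙ(Q, P)` with `H¹(M; ℤ)`
(`exists_equiv_horizontalDistance`), and the translation action of `H¹(M; ℤ)` on itself is carried
to the required action.

*Existence.* A covering maps local sections of `Q` to local sections of `P` and raises transition
functions to the `n`-th power, so `n • e(Q) = e(P)` (`IsFiberwiseCovering.isEulerClass_nsmul`).
Conversely, if this equation holds, the logarithms `n * r` and `r'` of the transition functions
differ by a real cocycle and integers. Splitting this cocycle by a partition of unity
permits to change the local sections of `P` in such a way that the transition functions become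
exactly `n`-th powers, and the local coverings fit together (`exists_isFiberwiseCovering`).
-/

noncomputable section

namespace CircleBundle

universe u v w

/-! ### Partitions of unity and real Čech cocycles -/

theorem PointedCover.mem_inter_pair {X : Type u} [TopologicalSpace X] {U : PointedCover X}
    {x y m : X} (hx : m ∈ U x) (hy : m ∈ U y) : m ∈ U.inter ![x, y] := by
  intro j
  fin_cases j
  exacts [hx, hy]

theorem cechD_zero {X : Type u} {A : Type v} [AddCommGroup A] (b : X → X → A)
    (i : Fin 2 → X) (m : X) :
    cechD (k := 0) (fun j => b (j 0)) i m = b (i 1) m - b (i 0) m := by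
  change ∑ j : Fin 2, (-1 : ℤ) ^ (j : ℕ) • b (i (j.succAbove 0)) m = _
  have h0 : (0 : Fin 2).succAbove (0 : Fin 1) = 1 := rfl
  have h1 : (1 : Fin 2).succAbove (0 : Fin 1) = 0 := rfl
  simp [Fin.sum_univ_two, h0, h1, sub_eq_add_neg]

/-- A partition of unity splits every Čech `1`-cocycle of continuous real functions: for
`∑ ρ y = 1` the functions `h x = ∑ ρ y * u y x` satisfy `h y - h x = u x y`. -/
theorem exists_eq_sub_of_cechD_eq_zero {M : Type u} [TopologicalSpace M] [T2Space M]
    [CompactSpace M] (U : PointedCover M) (u : M → M → M → ℝ)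
    (hu : ∀ x y, ContinuousOn (u x y) ((U x : Set M) ∩ U y))
    (hd : ∀ x y z m, m ∈ U x → m ∈ U y → m ∈ U z → u x z m = u x y m + u y z m) :
    ∃ h : M → M → ℝ, (∀ x, ContinuousOn (h x) (U x)) ∧
      ∀ x y m, m ∈ U x → m ∈ U y → u x y m = h y m - h x m := by
  obtain ⟨ρ, hρ⟩ := PartitionOfUnity.exists_isSubordinate (X := M) isClosed_univ
    (fun x => (U x : Set M)) (fun x => (U x).isOpen)
    (fun x _ => Set.mem_iUnion.2 ⟨x, (U x).mem⟩)
  refine ⟨fun x m => ∑ᶠ y, ρ y m * u y x m, fun x => ?_, fun x z m hx hz => ?_⟩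
  · have hy : ∀ y, ContinuousOn (fun m => ρ y m * u y x m) (U x) := by
      refine fun y m hm => ContinuousAt.continuousWithinAt ?_
      by_cases hy : m ∈ tsupport (ρ y)
      · exact (ρ y).continuous.continuousAt.mul ((hu y x).continuousAt
          (((U y).isOpen.inter (U x).isOpen).mem_nhds ⟨hρ y hy, hm⟩))
      · refine (continuousAt_const (y := (0 : ℝ))).congr ?_
        filter_upwards [(isClosed_tsupport (ρ y)).isOpen_compl.mem_nhds hy] with m' hm'
        rw [image_eq_zero_of_notMem_tsupport hm', zero_mul]
    rw [continuousOn_iff_continuous_domRestrict]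
    refine continuous_finsum (f := fun y (m : (U x : Set M)) => ρ y m * u y x m)
      (fun y => (hy y).domRestrict) ?_
    refine (ρ.locallyFinite.preimage_continuous
      (continuous_subtype_val (p := (· ∈ (U x : Set M))))).subset fun y m hm => ?_
    exact left_ne_zero_of_mul hm
  · have hfin : ∀ z, (Function.support fun y => ρ y m * u y z m).Finite := fun z =>
      (ρ.locallyFinite.point_finite m).subset fun y hy => left_ne_zero_of_mul hy
    rw [← finsum_sub_distrib (hfin z) (hfin x)]
    have key : ∀ y, ρ y m * u y z m - ρ y m * u y x m = ρ y m * u x z m := by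
      intro y
      by_cases hy : ρ y m = 0
      · simp [hy]
      · have hm : m ∈ U y := hρ y (subset_tsupport _ hy)
        rw [hd y x z m hm hx hz]
        ring
    rw [finsum_congr key, ← finsum_mul, ρ.sum_eq_one (Set.mem_univ m), one_mul]

/-! ### Degree one classes of maps to the circle -/

section CircleMaps

variable {M : Type u} [TopologicalSpace M]

/-- The class `f^*[S¹] ∈ H¹(M; ℤ)` of a map to the circle. -/
def circleMapClass (f : C(M, Circle)) : CechH M 1 :=
  cechMap f 1 circleClass

/-- The class of a map to the circle is represented by the differences of arbitrary local
logarithms `h x` of the map, in place of the standard ones. -/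
theorem circleMapClass_eq_cechClass (f : C(M, Circle)) (U : PointedCover M) (h : M → M → ℝ)
    (c : cechCocycle M 1) (hc : ∀ x, ContinuousOn (h x) (U x))
    (hf : ∀ x, ∀ m ∈ U x, circ (h x m) = f m)
    (hcc : ∀ i, ∀ m ∈ U.inter i, (c.1 i m : ℝ) = h (i 0) m - h (i 1) m) :
    circleMapClass f = cechClass M c := by
  let V : PointedCover M := fun x => U x ⊓ slitNhd.pullback f x
  let b : M → M → ℤ := fun x m => round (h x m - circleLog (f x) (f m))
  have hb1 : ∀ x, ∀ m ∈ V x, circ (h x m - circleLog (f x) (f m)) = 1 := fun x m hm => by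
    rw [circ_sub, circ_circleLog, hf x m hm.1, div_self']
  have hbc : ∀ x, ContinuousOn (b x) (V x) := fun x =>
    continuousOn_round (((hc x).mono fun m hm => hm.1).sub
      ((continuousOn_circleLog (f x)).comp f.continuous.continuousOn fun m hm => hm.2)) (hb1 x)
  refine (QuotientAddGroup.eq (s := (cechCoboundary M 1).addSubgroupOf (cechCocycle M 1))).2 ?_
  refine AddSubgroup.mem_sup.2 ⟨cechD (k := 0) (fun j => -b (j 0)),
    ⟨fun j => -b (j 0), ⟨V, fun i =>
      ((hbc (i 0)).mono fun m (hm : m ∈ V.inter i) => hm 0).neg⟩, rfl⟩,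
    -cechPullback f ℤ 1 circleCochain + c.1 - cechD (k := 0) (fun j => -b (j 0)),
    ⟨V, fun i m hm => ?_⟩, by simp; rfl⟩
  change -circleCochain (f ∘ i) (f m) + c.1 i m - cechD (k := 0) (fun j => (-b) (j 0)) i m = 0
  rw [cechD_zero, ← Int.cast_inj (α := ℝ)]
  have hb : ∀ j, (b (i j) m : ℝ) = h (i j) m - circleLog (f (i j)) (f m) := fun j =>
    round_of_circ (hb1 _ _ (hm j))
  push_cast [coe_circleCochain, Pi.neg_apply, hb, hcc i m fun j => (hm j).1]
  simp only [Function.comp_apply]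
  ring

theorem circleMapClass_mul (f g : C(M, Circle)) :
    circleMapClass (f * g) = circleMapClass f + circleMapClass g := by
  let cf : cechCocycle M 1 := ⟨_, cechPullback_cocycle f circleCochain_mem⟩
  let cg : cechCocycle M 1 := ⟨_, cechPullback_cocycle g circleCochain_mem⟩
  refine circleMapClass_eq_cechClass (f * g)
    (fun x => slitNhd.pullback f x ⊓ slitNhd.pullback g x)
    (fun x m => circleLog (f x) (f m) + circleLog (g x) (g m)) (cf + cg) (fun x => ?_)
    (fun x m _ => ?_) fun i m _ => ?_
  · exact ((continuousOn_circleLog (f x)).comp f.continuous.continuousOn fun m hm => hm.1).add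
      ((continuousOn_circleLog (g x)).comp g.continuous.continuousOn fun m hm => hm.2)
  · rw [circ_add, circ_circleLog, circ_circleLog, ContinuousMap.mul_apply]
  · change ((circleCochain (f ∘ i) (f m) + circleCochain (g ∘ i) (g m) : ℤ) : ℝ) = _
    push_cast [coe_circleCochain]
    simp only [Function.comp_apply]
    ring

theorem circleMapClass_eq_zero_of_lift {f : C(M, Circle)} (g : C(M, ℝ))
    (h : ∀ m, circ (g m) = f m) : circleMapClass f = 0 :=
  circleMapClass_eq_cechClass f (fun _ => ⊤) (fun _ => g) 0 (fun _ => g.continuous.continuousOn)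
    (fun _ m _ => h m) fun i m _ => by simp

/-- The homomorphism `f ↦ f^*[S¹]`. -/
def circleMapClassHom (M : Type u) [TopologicalSpace M] :
    C(M, Circle) →* Multiplicative (CechH M 1) where
  toFun f := Multiplicative.ofAdd (circleMapClass f)
  map_one' := congrArg _ (circleMapClass_eq_zero_of_lift 0 fun m => by simp [circ])
  map_mul' f g := congrArg _ (circleMapClass_mul f g)

/-- If `f^*[S¹] = 0` then the local logarithms of `f` can be adjusted by locally constant integer
valued functions so as to fit together. -/
theorem exists_lift_of_circleMapClass_eq_zero {f : C(M, Circle)} (hf : circleMapClass f = 0) :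
    ∃ g : C(M, ℝ), ∀ m, circ (g m) = f m := by
  have hf' := (QuotientAddGroup.eq_zero_iff
    (N := (cechCoboundary M 1).addSubgroupOf (cechCocycle M 1)) _).1 hf
  obtain ⟨_, ⟨b, ⟨V, hb⟩, rfl⟩, z, ⟨W, hz⟩, hsum⟩ := AddSubgroup.mem_sup.1 hf'
  let β : M → M → ℤ := fun x => b ![x]
  have hbβ : b = fun j => β (j 0) := by
    funext j
    exact congrArg b (by ext l; rw [Fin.fin_one_eq_zero l]; rfl)
  have key : ∀ x y m, m ∈ W x → m ∈ W y →
      circleLog (f x) (f m) + β x m = circleLog (f y) (f m) + β y m := by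
    intro x y m hx hy
    have h1 : cechD b ![x, y] m + z ![x, y] m = circleCochain (f ∘ ![x, y]) (f m) :=
      congrFun (congrFun hsum ![x, y]) m
    rw [hz _ _ (PointedCover.mem_inter_pair hx hy), add_zero, hbβ, cechD_zero,
      ← Int.cast_inj (α := ℝ), coe_circleCochain] at h1
    push_cast at h1
    simp only [Function.comp_apply, Matrix.cons_val_zero, Matrix.cons_val_one] at h1
    linarith
  have hcont : Continuous fun m => circleLog (f m) (f m) + β m m := by
    rw [continuous_iff_continuousAt]
    intro x
    have hc : ContinuousAt (fun m => circleLog (f x) (f m) + β x m) x := by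
      have h1 : ContinuousAt (fun m => circleLog (f x) (f m)) x :=
        ((continuousOn_circleLog (f x)).continuousAt
          ((slitNhd (f x)).isOpen.mem_nhds (slitNhd (f x)).mem)).comp f.continuous.continuousAt
      have h2 : ContinuousAt (β x) x := (hb ![x]).continuousAt
        (Filter.mem_of_superset ((V x).isOpen.mem_nhds (V x).mem)
          fun m hm j => by rw [Fin.fin_one_eq_zero j]; exact hm)
      exact h1.add (continuous_of_discreteTopology.continuousAt.comp h2)
    refine hc.congr ?_
    filter_upwards [(W x).isOpen.mem_nhds (W x).mem] with m hm
    exact key x m m hm (W m).mem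
  refine ⟨⟨_, hcont⟩, fun m => ?_⟩
  change circ (_ + (β m m : ℝ)) = _
  rw [circ_add, circ_circleLog, circ_eq_one.2 ⟨β m m, rfl⟩, mul_one]

/-- Over a compact space the maps to the circle with trivial class form an open subgroup, as it
contains the maps that avoid `-1`. -/
theorem isOpen_ker_circleMapClassHom [CompactSpace M] :
    IsOpen ((circleMapClassHom M).ker : Set C(M, Circle)) := by
  refine Subgroup.isOpen_of_mem_nhds _ (g := 1) (Filter.mem_of_superset
    ((ContinuousMap.isOpen_setOfPred_mapsTo isCompact_univ (slitNhd 1).isOpen).mem_nhds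
      fun m _ => (slitNhd 1).mem) fun f hf => ?_)
  have hc : Continuous fun m => circleLog 1 (f m) :=
    (continuousOn_circleLog 1).comp_continuous f.continuous fun m => hf (Set.mem_univ m)
  exact circleMapClass_eq_zero_of_lift ⟨_, hc⟩ fun m => circ_circleLog _ _

/-- A path of maps to the circle that starts at the constant map `1` stays in the open and closed
subgroup of the maps with trivial class. -/
theorem circleMapClass_eq_zero_of_path [CompactSpace M] (F : C(unitInterval, C(M, Circle)))
    (h0 : F 0 = 1) : circleMapClass (F 1) = 0 := by
  have hclopen : IsClopen ((circleMapClassHom M).ker : Set C(M, Circle)) :=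
    ⟨Subgroup.isClosed_of_isOpen _ isOpen_ker_circleMapClassHom, isOpen_ker_circleMapClassHom⟩
  have huniv := (hclopen.preimage F.continuous).eq_univ ⟨0, by simp [h0]⟩
  exact (huniv.symm ▸ Set.mem_univ (1 : unitInterval) :
    (1 : unitInterval) ∈ F ⁻¹' ((circleMapClassHom M).ker : Set C(M, Circle)))

/-- Every class of degree one comes from a map to the circle: write an integral cocycle as a
coboundary of continuous real functions `h x`; then the `circ ∘ h x` fit together. -/
theorem circleMapClass_surjective [T2Space M] [CompactSpace M] :
    Function.Surjective (circleMapClass (M := M)) := by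
  intro α
  obtain ⟨⟨c, ⟨U, hU⟩, ⟨V, hV⟩⟩, rfl⟩ := QuotientAddGroup.mk_surjective α
  let W : PointedCover M := fun x => U x ⊓ V x
  obtain ⟨h, hh, hhc⟩ := exists_eq_sub_of_cechD_eq_zero W (fun x y m => (c ![x, y] m : ℝ))
    (fun x y => Continuous.comp_continuousOn continuous_of_discreteTopology
      ((hU ![x, y]).mono fun m hm => PointedCover.mem_inter_pair hm.1.1 hm.2.1))
    (fun x y z m hx hy hz => by
      have h1 := hV ![x, y, z] m fun j => by
        fin_cases j
        exacts [hx.2, hy.2, hz.2]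
      rw [cechD_one] at h1
      have h2 : c ![x, z] m = c ![x, y] m + c ![y, z] m := by
        change c ![y, z] m - c ![x, z] m + c ![x, y] m = 0 at h1
        omega
      exact_mod_cast h2)
  have key : ∀ x y m, m ∈ W x → m ∈ W y → circ (-h x m) = circ (-h y m) := by
    intro x y m hx hy
    have h1 : -h x m = -h y m + (c ![x, y] m : ℝ) := by
      rw [hhc x y m hx hy]
      ring
    rw [h1, circ_add, circ_eq_one.2 ⟨_, rfl⟩, mul_one]
  have hcirc : Continuous circ := by
    unfold circ
    fun_prop
  have hcont : Continuous fun m => circ (-h m m) := by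
    rw [continuous_iff_continuousAt]
    intro x
    have hx := (W x).isOpen.mem_nhds (W x).mem
    have hc : ContinuousAt (fun m => circ (-h x m)) x :=
      hcirc.continuousAt.comp ((hh x).continuousAt hx).neg
    refine hc.congr ?_
    filter_upwards [hx] with m hm using key x m m hm (W m).mem
  refine ⟨⟨_, hcont⟩, circleMapClass_eq_cechClass _ W (fun x m => -h x m) _
    (fun x => (hh x).neg) (fun x m hm => key x m m hm (W m).mem) fun i m hm => ?_⟩
  have hi : i = ![i 0, i 1] := by
    ext j
    fin_cases j <;> rfl
  have h1 := hhc (i 0) (i 1) m (hm 0) (hm 1)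
  rw [← hi] at h1
  rw [h1]
  ring

end CircleMaps

/-! ### Circle actions on bundles and fiberwise coverings -/

section Action

variable {M : Type u} {Q : Type v} [TopologicalSpace M] [TopologicalSpace Q]
  [MulAction Circle Q] {π : Q → M}

theorem IsCircleBundle.continuous_proj (hπ : IsCircleBundle π) : Continuous π := by
  rw [continuous_iff_continuousAt]
  intro q
  obtain ⟨e, hx, -⟩ := hπ.exists_trivialization (π q)
  exact e.continuousAt_proj (e.mem_source.2 hx)

/-- The action on a circle bundle is jointly continuous, as it is so in local trivializations. -/
theorem IsCircleBundle.continuousOn_smul (hπ : IsCircleBundle π) {X : Type w}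
    [TopologicalSpace X] {S : Set X} {a : X → Q} {g : X → Circle} (ha : ContinuousOn a S)
    (hg : ContinuousOn g S) : ContinuousOn (fun m => g m • a m) S := by
  intro m hm
  obtain ⟨e, hx, he⟩ := hπ.exists_trivialization (π (a m))
  have ca : ContinuousWithinAt (fun m => e (a m)) S m :=
    (e.continuousAt (e.mem_source.2 hx)).comp_continuousWithinAt (ha m hm)
  have cπ : ContinuousWithinAt (fun m => π (a m)) S m :=
    hπ.continuous_proj.continuousAt.comp_continuousWithinAt (ha m hm)
  have key : ∀ m', a m' ∈ e.source → g m' • a m' =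
      e.toOpenPartialHomeomorph.symm (π (a m'), g m' * (e (a m')).2) := by
    intro m' hs
    have hs' := e.mem_source.1 hs
    have h1 := e.symm_apply_mk_proj (x := g m' • a m')
      (e.mem_source.2 (by rwa [hπ.proj_smul]))
    rw [hπ.proj_smul, he _ _ hs'] at h1
    exact h1.symm
  have hev : ∀ᶠ m' in 𝓝[S] m, a m' ∈ e.source :=
    (ha m hm).eventually (e.open_source.mem_nhds (e.mem_source.2 hx))
  have csymm : ContinuousAt e.toOpenPartialHomeomorph.symm (π (a m), g m * (e (a m)).2) :=
    e.toOpenPartialHomeomorph.continuousAt_symm (e.mem_target.2 hx)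
  refine ContinuousWithinAt.congr_of_eventuallyEq (f := fun m' =>
    e.toOpenPartialHomeomorph.symm (π (a m'), g m' * (e (a m')).2))
    (csymm.comp_continuousWithinAt (f := fun m' => (π (a m'), g m' * (e (a m')).2))
      (cπ.prodMk ((hg m hm).mul ca.snd))) ?_ (key m (e.mem_source.2 hx))
  filter_upwards [hev] with m' h1 using key m' h1

theorem IsCircleBundle.continuous_smul (hπ : IsCircleBundle π) {X : Type w}
    [TopologicalSpace X] {a : X → Q} {g : X → Circle} (ha : Continuous a)
    (hg : Continuous g) : Continuous fun m => g m • a m :=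
  continuousOn_univ.1 (hπ.continuousOn_smul ha.continuousOn hg.continuousOn)

end Action

theorem continuous_circ : Continuous circ := by
  unfold circ
  fun_prop

theorem circ_zero : circ 0 = 1 := by simp [circ]

theorem circ_natCast_mul (n : ℕ) (t : ℝ) : circ (n * t) = circ t ^ n := by
  induction n with
  | zero => simp [circ]
  | succ n ih => rw [pow_succ, ← ih, ← circ_add]; push_cast; ring_nf

/-- Exponents `k t` such that `t ↦ θ ^ k t` is continuous for every `θ` on the circle are constant
on connected sets: for `θ` a `p`-th root of unity the function takes finitely many values, hence
is constant, so that the exponent is constant modulo `p`. -/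
theorem pow_exponent_constant {X : Type*} [TopologicalSpace X] [PreconnectedSpace X] (k : X → ℕ)
    (hk : ∀ θ : Circle, Continuous fun t => θ ^ k t) (s t : X) : k s = k t := by
  let p : ℕ := k s + k t + 1
  have hp : (p : ℝ) ≠ 0 := by positivity
  let θ : Circle := circ (1 / p)
  have hθ : ∀ m : ℕ, θ ^ m = circ (m * (1 / p)) := fun m => (circ_natCast_mul m _).symm
  have hθp : θ ^ p = 1 := by
    rw [hθ, mul_one_div_cancel hp]
    exact circ_eq_one.2 ⟨1, by simp⟩
  have hfin : (Set.range fun t => θ ^ k t).Finite := by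
    refine ((Set.finite_Iio p).image fun m => θ ^ m).subset ?_
    rintro _ ⟨t, rfl⟩
    exact ⟨k t % p, Nat.mod_lt _ (Nat.succ_pos _), (pow_eq_pow_mod _ hθp).symm⟩
  have heq : θ ^ k s = θ ^ k t := by
    by_contra hne
    exact (isPreconnected_range (hk θ)).infinite_of_nontrivial
      ⟨_, ⟨s, rfl⟩, _, ⟨t, rfl⟩, hne⟩ hfin
  rw [hθ, hθ, ← div_eq_one, ← circ_sub, circ_eq_one] at heq
  obtain ⟨j, hj⟩ := heq
  have hj' : (k s : ℤ) - k t = j * p := by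
    have : (k s : ℝ) - k t = j * p := by
      rw [← hj]
      field_simp
    exact_mod_cast this
  have hj0 : j = 0 := by
    have hpd : (p : ℤ) = k s + k t + 1 := by simp [p]
    by_contra h0
    rcases Int.lt_or_gt_of_ne h0 with h | h <;> nlinarith
  rw [hj0] at hj'
  omega

section Covering

variable {M : Type u} {Q : Type v} {P : Type w} [TopologicalSpace M]
  [TopologicalSpace Q] [MulAction Circle Q] [TopologicalSpace P] [MulAction Circle P]
  {πQ : Q → M} {πP : P → M}

/-- The map `q ↦ f(πQ q) • φ q`, that is, `φ` rotated in the fibres by `f`. -/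
def rotate (hQ : IsCircleBundle πQ) (hP : IsCircleBundle πP) (f : C(M, Circle)) (φ : C(Q, P)) :
    C(Q, P) :=
  ⟨fun q => f (πQ q) • φ q,
    hP.continuous_smul φ.continuous (f.continuous.comp hQ.continuous_proj)⟩

theorem IsFiberwiseCovering.rotate (hQ : IsCircleBundle πQ) (hP : IsCircleBundle πP) {n : ℕ}
    (f : C(M, Circle)) {φ : C(Q, P)} (h : IsFiberwiseCovering πQ πP n φ) :
    IsFiberwiseCovering πQ πP n (rotate hQ hP f φ) := by
  refine ⟨h.1, fun q => ?_, fun θ q => ?_⟩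
  · change πP (f (πQ q) • φ q) = _
    rw [hP.proj_smul, h.2.1]
  · change f (πQ (θ • q)) • φ (θ • q) = θ ^ n • f (πQ q) • φ q
    rw [hQ.proj_smul, h.2.2, smul_comm]

theorem relativeMap_eq (hQ : IsCircleBundle πQ) (hP : IsCircleBundle πP) {n : ℕ}
    {φ₁ φ₂ : C(Q, P)} (h₁ : IsFiberwiseCovering πQ πP n φ₁)
    (h₂ : IsFiberwiseCovering πQ πP n φ₂) {f : C(M, Circle)}
    (hf : ∀ q, f (πQ q) • φ₁ q = φ₂ q) : relativeMap hQ hP h₁ h₂ = f :=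
  (exists_relativeMap hQ hP h₁ h₂).unique (relativeMap_smul hQ hP h₁ h₂) hf

theorem relativeMap_rotate (hQ : IsCircleBundle πQ) (hP : IsCircleBundle πP) {n : ℕ}
    {φ : C(Q, P)} (h : IsFiberwiseCovering πQ πP n φ) (f : C(M, Circle)) :
    relativeMap hQ hP h (h.rotate hQ hP f) = f :=
  relativeMap_eq hQ hP _ _ fun _ => rfl

theorem horizontalDistance_add (hQ : IsCircleBundle πQ) (hP : IsCircleBundle πP) {n : ℕ}
    {φ₁ φ₂ φ₃ : C(Q, P)} (h₁ : IsFiberwiseCovering πQ πP n φ₁)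
    (h₂ : IsFiberwiseCovering πQ πP n φ₂) (h₃ : IsFiberwiseCovering πQ πP n φ₃) :
    horizontalDistance hQ hP h₂ h₃ + horizontalDistance hQ hP h₁ h₂ =
      horizontalDistance hQ hP h₁ h₃ := by
  refine (circleMapClass_mul _ _).symm.trans (congrArg circleMapClass
    (relativeMap_eq hQ hP h₁ h₃ fun q => ?_).symm)
  rw [ContinuousMap.mul_apply, mul_smul, relativeMap_smul, relativeMap_smul]

/-- The number of sheets is constant along a homotopy through fiberwise coverings. -/
theorem isFiberwiseCovering_of_homotopy (hP : IsCircleBundle πP) {n : ℕ} {φ₁ φ₂ : C(Q, P)}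
    (h₁ : IsFiberwiseCovering πQ πP n φ₁)
    (H : φ₁.HomotopyWith φ₂ fun χ => ∃ n, IsFiberwiseCovering πQ πP n χ) (t : unitInterval) :
    IsFiberwiseCovering πQ πP n (H.toHomotopy.curry t) := by
  choose k hk using fun t =>
    (H.prop' t : ∃ k, IsFiberwiseCovering πQ πP k (H.toHomotopy.curry t))
  refine ⟨h₁.1, (hk t).2.1, fun θ q => ?_⟩
  have hcont : ∀ θ : Circle, Continuous fun t => θ ^ k t := fun θ =>
    continuousOn_univ.1 <| hP.continuousOn_of_smul (a := fun t => H (t, q))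
      (b := fun t => H (t, θ • q)) (by fun_prop) (by fun_prop) fun t _ => ((hk t).2.2 θ q).symm
  have h0 : θ ^ k 0 = θ ^ n := by
    refine hP.smul_injective (q := φ₁ q) ?_
    have h1 : H (0, θ • q) = θ ^ k 0 • H (0, q) := (hk 0).2.2 θ q
    rw [H.apply_zero, H.apply_zero, h₁.2.2] at h1
    exact h1.symm
  rw [← h0, pow_exponent_constant k hcont 0 t]
  exact (hk t).2.2 θ q

/-- The maps relating a fiberwise covering to the members of a homotopy starting from it form a
path of maps to the circle. -/
theorem horizontalDistance_eq_zero_of_homotopy [CompactSpace M] (hQ : IsCircleBundle πQ)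
    (hP : IsCircleBundle πP) {n : ℕ} {φ₁ φ₂ : C(Q, P)} (h₁ : IsFiberwiseCovering πQ πP n φ₁)
    (h₂ : IsFiberwiseCovering πQ πP n φ₂)
    (H : φ₁.HomotopyWith φ₂ fun χ => ∃ n, IsFiberwiseCovering πQ πP n χ) :
    horizontalDistance hQ hP h₁ h₂ = 0 := by
  have hH := isFiberwiseCovering_of_homotopy hP h₁ H
  let G : unitInterval × M → Circle := fun z => relativeMap hQ hP h₁ (hH z.1) z.2
  have hG : ∀ t q, G (t, πQ q) • φ₁ q = H (t, q) := fun t q =>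
    relativeMap_smul hQ hP h₁ (hH t) q
  have hGc : Continuous G := by
    rw [continuous_iff_continuousAt]
    rintro ⟨t, x⟩
    obtain ⟨e, s, hx, hs, hs', -⟩ := hQ.exists_section x
    have hs2 : ContinuousOn (fun z : unitInterval × M => s z.2) (Set.univ ×ˢ e.baseSet) :=
      hs.comp continuous_snd.continuousOn fun z hz => hz.2
    refine ContinuousOn.continuousAt (s := Set.univ ×ˢ e.baseSet) ?_
      ((isOpen_univ.prod e.open_baseSet).mem_nhds ⟨trivial, hx⟩)
    refine hP.continuousOn_of_smul (a := fun z => φ₁ (s z.2)) (b := fun z => H (z.1, s z.2))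
      (φ₁.continuous.comp_continuousOn hs2)
      (H.continuous.comp_continuousOn (continuous_fst.continuousOn.prodMk hs2)) fun z hz => ?_
    have h := hG z.1 (s z.2)
    rwa [hs' _ hz.2] at h
  let F : C(unitInterval, C(M, Circle)) := ContinuousMap.curry ⟨G, hGc⟩
  have h0 : F 0 = 1 := by
    refine (relativeMap_eq hQ hP h₁ (hH 0) fun q => ?_ : relativeMap hQ hP h₁ (hH 0) = 1)
    change (1 : Circle) • φ₁ q = H (0, q)
    rw [one_smul, H.apply_zero]
  have h1 : F 1 = relativeMap hQ hP h₁ h₂ := by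
    refine relativeMap_eq hQ hP h₁ (hH 1) fun q => ?_
    change _ = H (1, q)
    rw [H.apply_one, relativeMap_smul]
  exact (congrArg circleMapClass h1).symm.trans (circleMapClass_eq_zero_of_path F h0)

/-- If the relating map lifts to a real function `g`, the rotations by `circ (t * g)` are a
homotopy. -/
theorem homotopicWith_of_horizontalDistance_eq_zero (hQ : IsCircleBundle πQ)
    (hP : IsCircleBundle πP) {n : ℕ} {φ₁ φ₂ : C(Q, P)} (h₁ : IsFiberwiseCovering πQ πP n φ₁)
    (h₂ : IsFiberwiseCovering πQ πP n φ₂) (h : horizontalDistance hQ hP h₁ h₂ = 0) :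
    φ₁.HomotopicWith φ₂ fun χ => ∃ n, IsFiberwiseCovering πQ πP n χ := by
  obtain ⟨g, hg⟩ := exists_lift_of_circleMapClass_eq_zero h
  refine ⟨⟨⟨⟨fun z : unitInterval × Q => circ (z.1 * g (πQ z.2)) • φ₁ z.2, ?_⟩,
    fun q => ?_, fun q => ?_⟩, fun t => ⟨n, ?_⟩⟩⟩
  · have hπ := hQ.continuous_proj
    exact hP.continuous_smul (by fun_prop) (continuous_circ.comp (by fun_prop))
  · simp [circ_zero]
  · simp [hg, relativeMap_smul]
  · exact h₁.rotate hQ hP ⟨fun m => circ (t * g m), continuous_circ.comp (by fun_prop)⟩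

theorem covNClass_eq_iff [CompactSpace M] (hQ : IsCircleBundle πQ) (hP : IsCircleBundle πP)
    {n : ℕ} {φ₁ φ₂ : C(Q, P)} (h₁ : IsFiberwiseCovering πQ πP n φ₁)
    (h₂ : IsFiberwiseCovering πQ πP n φ₂) :
    covNClass h₁ = covNClass h₂ ↔ horizontalDistance hQ hP h₁ h₂ = 0 := by
  refine Subtype.ext_iff.trans ⟨fun h => ?_, fun h => ?_⟩
  · obtain ⟨H⟩ := Quotient.exact h
    exact horizontalDistance_eq_zero_of_homotopy hQ hP h₁ h₂ H
  · exact Quotient.sound (homotopicWith_of_horizontalDistance_eq_zero hQ hP h₁ h₂ h)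

/-! ### Euler classes and the existence of fiberwise coverings -/

/-- The images of local sections of `Q` are local sections of `P`, whose transition functions are
the `n`-th powers of those of `Q`. -/
theorem IsFiberwiseCovering.isEulerClass_nsmul {n : ℕ} {φ : C(Q, P)}
    (h : IsFiberwiseCovering πQ πP n φ) {e : CechH M 2} (he : IsEulerClass πQ e) :
    IsEulerClass πP (n • e) := by
  obtain ⟨U, s, r, c, hs, hsπ, hr, hsr, hc, rfl⟩ := he
  refine ⟨U, fun x m => φ (s x m), fun i m => n * r i m, n • c,
    fun x => φ.continuous.comp_continuousOn (hs x), fun x m hm => ?_,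
    fun i => continuousOn_const.mul (hr i), fun i m hm => ?_, fun i m hm => ?_, rfl⟩
  · rw [h.2.1, hsπ x m hm]
  · change φ (s (i 1) m) = circ (n * r i m) • φ (s (i 0) m)
    rw [hsr i m hm, h.2.2, circ_natCast_mul]
  · change ((n • c.1 i m : ℤ) : ℝ) = _
    have h1 := hc i m hm
    rw [cechD_one] at h1 ⊢
    rw [nsmul_eq_mul]
    push_cast
    rw [h1]
    ring

/-- Given `n • e(Q) = e(P)`, there are local sections `s x` of `Q` and `s' x` of `P` such that the
transition functions of the latter are the `n`-th powers of those of the former: the real cocycle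
comparing the logarithms is split by a partition of unity, and absorbed in the sections of `P`.
The maps `θ • s x ↦ θⁿ • s' x` then fit together. -/
theorem exists_isFiberwiseCovering [T2Space M] [CompactSpace M] (hQ : IsCircleBundle πQ)
    (hP : IsCircleBundle πP) {n : ℕ} (hn : 0 < n) {e : CechH M 2} (heQ : IsEulerClass πQ e)
    (heP : IsEulerClass πP (n • e)) : ∃ φ : C(Q, P), IsFiberwiseCovering πQ πP n φ := by
  obtain ⟨U, s, r, c, hs, hsπ, hr, hsr, hc, rfl⟩ := heQ
  obtain ⟨U', s', r', c', hs', hsπ', hr', hsr', hc', hcc⟩ := heP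
  obtain ⟨_, ⟨b, ⟨V, hb⟩, rfl⟩, z, ⟨W, hz⟩, hsum⟩ := AddSubgroup.mem_sup.1
    ((QuotientAddGroup.eq (s := (cechCoboundary M 2).addSubgroupOf (cechCocycle M 2))
      (a := n • c) (b := c')).1 hcc)
  let N : PointedCover M := fun x => (U x ⊓ U' x) ⊓ (V x ⊓ W x)
  have hNU : ∀ {x m}, m ∈ N x → m ∈ U x := fun hm => hm.1.1
  have hNU' : ∀ {x m}, m ∈ N x → m ∈ U' x := fun hm => hm.1.2
  -- the discrepancy between the `n`-th powers and the transition functions of `P`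
  obtain ⟨h, hhc, hh⟩ := exists_eq_sub_of_cechD_eq_zero N
    (fun x y m => n * r ![x, y] m - r' ![x, y] m + b ![x, y] m)
    (fun x y => by
      refine ((continuousOn_const.mul ((hr ![x, y]).mono fun m hm => ?_)).sub
        ((hr' ![x, y]).mono fun m hm => ?_)).add
        (continuous_of_discreteTopology.comp_continuousOn ((hb ![x, y]).mono fun m hm => ?_))
      · exact PointedCover.mem_inter_pair hm.1.1.1 hm.2.1.1
      · exact PointedCover.mem_inter_pair hm.1.1.2 hm.2.1.2
      · exact PointedCover.mem_inter_pair hm.1.2.1 hm.2.2.1)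
    (fun x y z' m hx hy hz' => by
      have hm : ∀ j, m ∈ N (![x, y, z'] j) := fun j => by
        fin_cases j
        exacts [hx, hy, hz']
      have h1 := hc ![x, y, z'] m fun j => (hm j).1.1
      have h2 := hc' ![x, y, z'] m fun j => (hm j).1.2
      have h3 : cechD b ![x, y, z'] m + z ![x, y, z'] m =
          -(n • c.1 ![x, y, z'] m) + c'.1 ![x, y, z'] m :=
        congrFun (congrFun hsum ![x, y, z']) m
      rw [hz _ _ fun j => (hm j).2.2, cechD_one, nsmul_eq_mul, ← Int.cast_inj (α := ℝ)] at h3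
      push_cast at h3
      rw [h1, h2, cechD_one, cechD_one] at h3
      simp only [Matrix.cons_val_zero, Matrix.cons_val_one, Matrix.cons_val] at h3
      linarith)
  have hθ : ∀ x q, ∃ θ : Circle, πQ q ∈ N x → θ • s x (πQ q) = q := by
    intro x q
    by_cases hq : πQ q ∈ N x
    · obtain ⟨θ, hθ⟩ := hQ.exists_smul (q := s x (πQ q)) (q' := q)
        (by rw [hsπ _ _ (hNU hq)])
      exact ⟨θ, fun _ => hθ⟩
    · exact ⟨1, fun h1 => (hq h1).elim⟩
  choose θ hθ using hθ
  let Φ : M → Q → P := fun x q => (θ x q ^ n * circ (h x (πQ q))) • s' x (πQ q)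
  have key : ∀ x y q, πQ q ∈ N x → πQ q ∈ N y → Φ x q = Φ y q := by
    intro x y q hx hy
    have h1 : s y (πQ q) = circ (r ![x, y] (πQ q)) • s x (πQ q) :=
      hsr ![x, y] _ (PointedCover.mem_inter_pair (hNU hx) (hNU hy))
    have h2 : s' y (πQ q) = circ (r' ![x, y] (πQ q)) • s' x (πQ q) :=
      hsr' ![x, y] _ (PointedCover.mem_inter_pair (hNU' hx) (hNU' hy))
    have h3 : θ x q = θ y q * circ (r ![x, y] (πQ q)) := by
      refine hQ.smul_injective (q := s x (πQ q)) ?_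
      rw [hθ x q hx, mul_smul, ← h1, hθ y q hy]
    have h4 : (n : ℝ) * r ![x, y] (πQ q) + h x (πQ q) + (b ![x, y] (πQ q) : ℝ) =
        h y (πQ q) + r' ![x, y] (πQ q) := by
      linarith [hh x y _ hx hy]
    have h5 := congrArg circ h4
    rw [circ_add, circ_eq_one.2 ⟨_, rfl⟩, mul_one, circ_add, circ_add, circ_natCast_mul] at h5
    simp only [Φ]
    rw [h2, smul_smul, h3, mul_pow, mul_assoc, mul_assoc, h5]
  have hΦc : ∀ x, ContinuousOn (Φ x) (πQ ⁻¹' N x) := by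
    intro x
    have hπ : ContinuousOn πQ (πQ ⁻¹' N x) := hQ.continuous_proj.continuousOn
    have hθc : ContinuousOn (θ x) (πQ ⁻¹' N x) := hQ.continuousOn_of_smul
      (a := fun q => s x (πQ q)) (b := id) ((hs x).comp hπ fun q hq => hNU hq) continuousOn_id
      fun q hq => hθ x q hq
    exact hP.continuousOn_smul ((hs' x).comp hπ fun q hq => hNU' hq)
      ((hθc.pow n).mul (continuous_circ.comp_continuousOn ((hhc x).comp hπ fun q hq => hq)))
  have hcont : Continuous fun q => Φ (πQ q) q := by
    rw [continuous_iff_continuousAt]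
    intro q
    have hq := ((N (πQ q)).isOpen.preimage hQ.continuous_proj).mem_nhds (N (πQ q)).mem
    refine ((hΦc (πQ q)).continuousAt hq).congr ?_
    filter_upwards [hq] with q' hq' using key _ _ q' hq' (N (πQ q')).mem
  refine ⟨⟨_, hcont⟩, hn, fun q => ?_, fun ϑ q => ?_⟩
  · change πP (Φ (πQ q) q) = πQ q
    rw [hP.proj_smul, hsπ' _ _ (hNU' (N (πQ q)).mem)]
  · change Φ (πQ (ϑ • q)) (ϑ • q) = ϑ ^ n • Φ (πQ q) q
    have hx := (N (πQ q)).mem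
    have h1 : θ (πQ q) (ϑ • q) = ϑ * θ (πQ q) q := by
      refine hQ.smul_injective (q := s (πQ q) (πQ q)) ?_
      have h2 := hθ (πQ q) (ϑ • q) (by rw [hQ.proj_smul]; exact hx)
      rw [hQ.proj_smul] at h2
      rw [h2, mul_smul, hθ _ _ hx]
    simp only [Φ, hQ.proj_smul]
    rw [h1, mul_pow, mul_assoc, mul_smul]

theorem covN_nonempty_iff [T2Space M] [CompactSpace M] (hQ : IsCircleBundle πQ)
    (hP : IsCircleBundle πP) {n : ℕ} (hn : 0 < n) :
    (CovN πQ πP n).Nonempty ↔ n • eulerClass hQ = eulerClass hP := by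
  constructor
  · rintro ⟨_, φ, h, -⟩
    exact hP.isEulerClass_unique (h.isEulerClass_nsmul (isEulerClass_eulerClass hQ))
      (isEulerClass_eulerClass hP)
  · intro h
    obtain ⟨φ, hφ⟩ := exists_isFiberwiseCovering hQ hP hn (isEulerClass_eulerClass hQ)
      (h ▸ isEulerClass_eulerClass hP)
    exact ⟨_, φ, hφ, rfl⟩

/-! ### The torsor of fiberwise coverings -/

/-- Once a covering `φ₀` is chosen, the horizontal distance from `φ₀` is a coordinate on
`Covₙ(Q, P)`. -/
theorem exists_equiv_horizontalDistance [T2Space M] [CompactSpace M] (hQ : IsCircleBundle πQ)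
    (hP : IsCircleBundle πP) {n : ℕ} {φ₀ : C(Q, P)} (h₀ : IsFiberwiseCovering πQ πP n φ₀) :
    ∃ E : CovN πQ πP n ≃ CechH M 1, ∀ (φ : C(Q, P)) (h : IsFiberwiseCovering πQ πP n φ),
      E (covNClass h) = horizontalDistance hQ hP h₀ h := by
  choose f hf using circleMapClass_surjective (M := M)
  have hG : ∀ α, horizontalDistance hQ hP h₀ (h₀.rotate hQ hP (f α)) = α := fun α =>
    (congrArg circleMapClass (relativeMap_rotate hQ hP h₀ (f α))).trans (hf α)
  have hdist : ∀ {φ ψ : C(Q, P)} (h : IsFiberwiseCovering πQ πP n φ)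
      (h' : IsFiberwiseCovering πQ πP n ψ), covNClass h = covNClass h' ↔
        horizontalDistance hQ hP h₀ h = horizontalDistance hQ hP h₀ h' := fun h h' => by
    rw [covNClass_eq_iff hQ hP h h', ← horizontalDistance_add hQ hP h₀ h h', right_eq_add]
  let G : CechH M 1 → CovN πQ πP n := fun α => covNClass (h₀.rotate hQ hP (f α))
  have hGinv : ∀ (φ : C(Q, P)) (h : IsFiberwiseCovering πQ πP n φ),
      G (horizontalDistance hQ hP h₀ h) = covNClass h := fun φ h =>
    (hdist _ _).2 (hG _)
  have hbij : Function.Bijective G := by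
    refine ⟨fun α β h => ?_, ?_⟩
    · rw [← hG α, ← hG β]
      exact (hdist _ _).1 h
    · rintro ⟨_, φ, h, rfl⟩
      exact ⟨_, hGinv φ h⟩
  refine ⟨(Equiv.ofBijective G hbij).symm, fun φ h => ?_⟩
  rw [Equiv.symm_apply_eq]
  exact (hGinv φ h).symm

end Covering

end CircleBundle

end

open CircleBundle in
/-- Classification of the fiberwise `n`-fold coverings between two circle bundles over a closed
manifold. -/
theorem theorem3p2 {d : ℕ} {M : Type*} [TopologicalSpace M] [T2Space M] [CompactSpace M]
    [ChartedSpace (EuclideanSpace ℝ (Fin d)) M]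
    {Q P : Type*} [TopologicalSpace Q] [MulAction Circle Q] [TopologicalSpace P]
    [MulAction Circle P] {πQ : Q → M} {πP : P → M} (hQ : IsCircleBundle πQ)
    (hP : IsCircleBundle πP) (n : ℕ) (hn : 0 < n) :
    ((CovN πQ πP n).Nonempty ↔ n • eulerClass hQ = eulerClass hP) ∧
    ((CovN πQ πP n).Nonempty →
      (∃ _ : AddAction (CechH M 1) (CovN πQ πP n),
        (∀ a b : CovN πQ πP n, ∃! α : CechH M 1, α +ᵥ a = b) ∧
        ∀ (φ₁ φ₂ : C(Q, P)) (h₁ : IsFiberwiseCovering πQ πP n φ₁)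
          (h₂ : IsFiberwiseCovering πQ πP n φ₂),
          horizontalDistance hQ hP h₁ h₂ +ᵥ covNClass h₁ = covNClass h₂) ∧
      Nonempty (CovN πQ πP n ≃ CechH M 1)) := by
  refine ⟨covN_nonempty_iff hQ hP hn, ?_⟩
  rintro ⟨_, φ₀, h₀, -⟩
  obtain ⟨E, hE⟩ := exists_equiv_horizontalDistance hQ hP h₀
  -- the translation action of `H¹(M; ℤ)` on itself, transported along `E`
  let A : AddAction (CechH M 1) (CovN πQ πP n) :=
    { vadd := fun α a => E.symm (α + E a)
      zero_vadd := fun a => by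
        change E.symm (0 + E a) = a
        rw [zero_add, E.symm_apply_apply]
      add_vadd := fun α β a => by
        change E.symm (α + β + E a) = E.symm (α + E (E.symm (β + E a)))
        rw [E.apply_symm_apply, add_assoc] }
  have hA : ∀ α a b, α +ᵥ a = b ↔ α + E a = E b := fun α a b => E.symm_apply_eq
  refine ⟨⟨A, fun a b => ⟨E b - E a, (hA _ _ _).2 (sub_add_cancel _ _), fun α h => ?_⟩,
    fun φ₁ φ₂ h₁ h₂ => (hA _ _ _).2 ?_⟩, ⟨E⟩⟩
  · exact eq_sub_of_add_eq ((hA _ _ _).1 h)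
  · rw [hE, hE, horizontalDistance_add]
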